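/- For an integer $\ell\ge 1$ and positive numbers $\alpha_1,\dots,\alpha_\ell$ (primary steps) and $\hat\alpha_1,\dots,\hat\alpha_\ell$ (dual steps), let $A$ be the tridiagonal $\ell\times\ell$ matrix of the difference operator $$(AV)_i=\frac1{\hat\alpha_i}\Big(\frac{V_{i+1}-V_i}{\alpha_i}-\frac{V_i-V_{i-1}}{\alpha_{i-1}}\Big),\qquad 1\le i\le \ell,$$ where $V_{\ell+1}=0$ and the term $(V_1-V_0)/\alpha_0$ is omitted for $i=1$. The spectral data of $A$ are the numbers $\xi_j,\delta_j$ ($1\le j\le\ell$), where $-\delta_j^2$ are the eigenvalues of $A$, $0<\delta_1<\dots<\delta_\ell$, and $\xi_j=Y_{1,j}^2$ is the square of the first component of an eigenvector $Y_j=(Y_{1,j},\dots,Y_{\ell,j})^T$ for $-\delta_j^2$ normalized by $\sum_{p=1}^\ell\hat\alpha_pY_{p,j}^2=1$. For every $\ell\ge1$ there are unique positive steps $\alpha_1,\dots,\alpha_\ell,\hat\alpha_1,\dots,\hat\alpha_\ell$ (the steps of the truncated measure optimal grid) for which the spectral data are $\xi_j=2$, $\delta_j=\pi(j-\tfrac12)$,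 $j=1,\dots,\ell$. They satisfy the monotone relation $$\hat\alpha_1<\alpha_1<\hat\alpha_2<\alpha_2<\dots<\hat\alpha_\ell<\alpha_\ell .$$ Moreover, the primary grid steps are $$\alpha_j=\begin{cases}\dfrac{2+O\big[(\ell-j)^{-1}+j^{-2}\big]}{\pi\sqrt{\ell^2-j^2}},&1\le j\le\ell-1,\\[2ex]\dfrac{\sqrt2+O(\ell^{-1})}{\sqrt{\pi\ell}},&j=\ell,\end{cases}$$ and the dual grid steps are $$\hat\alpha_j=\frac{2+O\big[(\ell+1-j)^{-1}+j^{-2}\big]}{\pi\sqrt{\ell^2-(j-1/2)^2}},\qquad 1\le j\le\ell,$$ where the constants in the $O$ terms are absolute: the bounds hold for all $\ell\ge1$ and all $j$ in the indicated ranges. -/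

import Mathlib

/-- The inverse of the primary step preceding `i`, i.e. `1 / α_{i-1}`, and `0` for the first row
(where the homogeneous Neumann condition removes this term). -/
noncomputable def prevInv {ℓ : ℕ} (α : Fin ℓ → ℝ) (i : Fin ℓ) : ℝ :=
  if 0 < i.val then 1 / α ⟨i.val - 1, (Nat.sub_le _ _).trans_lt i.isLt⟩ else 0

/-- The tridiagonal matrix `A` of the three-point difference operator
`V ↦ (1/α̂_i) * ((V_{i+1} - V_i)/α_i - (V_i - V_{i-1})/α_{i-1})` on a staggered grid with
primary steps `α` and dual steps `α̂ = αh`, with a homogeneous Neumann condition at the first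
node and `V_{ℓ+1} = 0`. The index `i : Fin ℓ` stands for the number `i + 1 ∈ {1, …, ℓ}`. -/
noncomputable def gridMatrix {ℓ : ℕ} (α αh : Fin ℓ → ℝ) : Matrix (Fin ℓ) (Fin ℓ) ℝ :=
  Matrix.of fun i j =>
    if j = i then -(1 / αh i) * (1 / α i + prevInv α i)
    else if j.val + 1 = i.val then 1 / (αh i * α j)
    else if i.val + 1 = j.val then 1 / (αh i * α i)
    else 0

/-- `(ξ_j, δ_j)` is the spectral data of the difference operator with steps `α, α̂ = αh`:
its eigenvalues are `-δ_j ^ 2` with `0 < δ_1 < ⋯ < δ_ℓ`, and `ξ_j` is the square of the first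
component of the `j`-th eigenvector `Y j`, normalized in the weighted inner product
`⟨a, b⟩ = ∑ p, α̂_p * a_p * b_p`. -/
def HasSpectralData {ℓ : ℕ} [NeZero ℓ] (α αh ξ δ : Fin ℓ → ℝ) : Prop :=
  StrictMono δ ∧ (∀ j, 0 < δ j) ∧
  ∃ Y : Fin ℓ → Fin ℓ → ℝ, ∀ j,
    (gridMatrix α αh).mulVec (Y j) = (-(δ j) ^ 2) • Y j ∧
    ∑ p, αh p * Y j p ^ 2 = 1 ∧
    Y j 0 ^ 2 = ξ j

/-- The steps `α, α̂ = αh` of the truncated measure optimal grid: positive numbers for which the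
difference operator has the spectral data `ξ_j = 2`, `δ_j = π (j - 1/2)`, `j = 1, …, ℓ`
(the index `j : Fin ℓ` stands for the number `j + 1`). -/
def IsTruncatedMeasureGrid {ℓ : ℕ} [NeZero ℓ] (α αh : Fin ℓ → ℝ) : Prop :=
  (∀ j, 0 < α j) ∧ (∀ j, 0 < αh j) ∧
  HasSpectralData α αh (fun _ => 2) (fun j => Real.pi * (((j.val : ℝ) + 1) - 1 / 2))

/-! List the steps as one sequence γ_0, γ_1, … = α̂_1, α_1, α̂_2, α_2, …. In first-order form, for
node values V and scaled differences W, the interleaved solution satisfies, up to signs, P_{n+1} =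
γ_n δ P_n - P_{n-1}. The prescribed data amount to equal weights on the 2ℓ equispaced points ±δ_j,
so the P_n are rescaled discrete Chebyshev polynomials. Their recurrence fixes every product γ_n
γ_{n+1}; together with γ_0 = 1/(2ℓ) this is solved by quotients of Gamma functions, which is
`gridStep`. Existence is then a verification (`isLadder_grid`, `isLadderFamily_grid`).

Uniqueness: the values V_j, and likewise the W_j, are orthonormal with the steps as weights.
Inverting the square matrix gives 1/α̂_p = ∑_j V_j(p)^2 and 1/α_p = ∑_j W_j(p+1)^2, so the common
initial value and the frequencies determine the steps one after another (`IsLadderFamily.unique`).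

Monotonicity and asymptotics: each of the two factors f of γ has an explicit product f(x) f(x+1). A
sharp one-sided bound on f(x)^2 then gives both the growth of f and the opposite bound. These bounds
rest on `le_gammaRatio_pow_four`. -/

open Real Filter Topology

/-! ### Bounds for quotients of Gamma functions -/

/-- The ratio `Γ((x+1)/2) / Γ(x/2)`. -/
noncomputable def gammaRatio (x : ℝ) : ℝ := Gamma ((x + 1) / 2) / Gamma (x / 2)

lemma gammaRatio_pos {x : ℝ} (hx : 0 < x) : 0 < gammaRatio x :=
  div_pos (Gamma_pos_of_pos (by linarith)) (Gamma_pos_of_pos (by linarith))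

lemma gammaRatio_mul_succ {x : ℝ} (hx : 0 < x) :
    gammaRatio x * gammaRatio (x + 1) = x / 2 := by
  have h1 := (Gamma_pos_of_pos (show 0 < (x + 1) / 2 by linarith)).ne'
  have h2 := (Gamma_pos_of_pos (show 0 < x / 2 by linarith)).ne'
  have h3 : Gamma ((x + 1 + 1) / 2) = x / 2 * Gamma (x / 2) := by
    rw [← Gamma_add_one (by positivity)]; congr 1; ring
  unfold gammaRatio
  rw [h3]; field_simp

lemma gammaRatio_one : gammaRatio 1 = 1 / √π := by
  unfold gammaRatio
  rw [Gamma_one_half_eq]; norm_num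

/-- Log-convexity of Γ: (x+1)/2 is the midpoint of x/2 and x/2 + 1. -/
lemma gammaRatio_sq_le {x : ℝ} (hx : 0 < x) : gammaRatio x ^ 2 ≤ x / 2 := by
  have h1 : 0 < Gamma (x / 2) := Gamma_pos_of_pos (by linarith)
  have h2 : Gamma (x / 2 + 1) = x / 2 * Gamma (x / 2) := Gamma_add_one (by positivity)
  have h := Gamma_mul_add_mul_le_rpow_Gamma_mul_rpow_Gamma (s := x / 2) (t := x / 2 + 1)
    (a := 1 / 2) (b := 1 / 2) (by positivity) (by positivity) (by norm_num) (by norm_num)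
    (by norm_num)
  rw [show 1 / 2 * (x / 2) + 1 / 2 * (x / 2 + 1) = (x + 1) / 2 by ring, ← sqrt_eq_rpow,
    ← sqrt_eq_rpow, ← sqrt_mul h1.le, h2] at h
  have h4 : 0 ≤ Gamma ((x + 1) / 2) := (Gamma_pos_of_pos (by linarith)).le
  have h5 := pow_le_pow_left₀ h4 h 2
  rw [sq_sqrt (by positivity)] at h5
  unfold gammaRatio
  rw [div_pow, div_le_iff₀ (by positivity)]
  linarith

/-- The product identity converts the upper bound at x + 1 into a lower bound at x. -/
lemma le_gammaRatio_sq {x : ℝ} (hx : 0 < x) : x ^ 2 / (2 * (x + 1)) ≤ gammaRatio x ^ 2 := by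
  have h0 := gammaRatio_mul_succ hx
  have h1 := gammaRatio_sq_le (show 0 < x + 1 by linarith)
  have h2 : gammaRatio x ^ 2 * gammaRatio (x + 1) ^ 2 = x ^ 2 / 4 := by
    rw [← mul_pow, h0]; ring
  rw [div_le_iff₀ (by positivity)]
  nlinarith [mul_le_mul_of_nonneg_left h1 (sq_nonneg (gammaRatio x))]

lemma gammaRatio_add_two {x : ℝ} (hx : 0 < x) :
    gammaRatio (x + 2) = (x + 1) / x * gammaRatio x := by
  have h0 := gammaRatio_mul_succ hx
  have h1 := gammaRatio_mul_succ (show 0 < x + 1 by linarith)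
  have h2 := gammaRatio_pos (show 0 < x + 1 by linarith)
  rw [show x + 1 + 1 = x + 2 by ring] at h1
  apply mul_left_cancel₀ h2.ne'
  rw [h1, show gammaRatio (x + 1) * ((x + 1) / x * gammaRatio x)
    = (x + 1) / x * (gammaRatio x * gammaRatio (x + 1)) by ring, h0]
  field_simp

/-- The quotient of `gammaRatio x ^ 4` by its asymptotic lower bound. -/
noncomputable def gammaRatioQuot (x : ℝ) : ℝ :=
  gammaRatio x ^ 4 * (4 * (2 * x + 1)) / (x ^ 2 * (2 * x - 1))

lemma gammaRatioQuot_add_two_le {x : ℝ} (hx : 1 ≤ x) :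
    gammaRatioQuot (x + 2) ≤ gammaRatioQuot x := by
  have hg := gammaRatio_pos (show 0 < x by linarith)
  have h1 : 0 < 2 * x - 1 := by linarith
  have h2 : 0 < 2 * (x + 2) - 1 := by linarith
  unfold gammaRatioQuot
  rw [gammaRatio_add_two (by linarith), mul_pow, div_pow]
  rw [div_le_div_iff₀ (by positivity) (by positivity)]
  -- With y = x + 1, and after division by x^2, this reads y^4 (4y^2 - 9) ≤ (4y^2 - 1)(y^2 - 1)^2,
  -- whose sides differ by 6y^2 - 1.
  have key : (x + 1) ^ 4 / x ^ 4 * ((2 * (x + 2) + 1) * (x ^ 2 * (2 * x - 1)))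
      ≤ (2 * x + 1) * ((x + 2) ^ 2 * (2 * (x + 2) - 1)) := by
    rw [div_mul_eq_mul_div, div_le_iff₀ (by positivity)]
    have : 0 ≤ x ^ 2 * (6 * (x + 1) ^ 2 - 1) :=
      mul_nonneg (sq_nonneg _) (by nlinarith)
    nlinarith
  have hg4 : 0 ≤ 4 * gammaRatio x ^ 4 := by positivity
  nlinarith [mul_le_mul_of_nonneg_left key hg4]

lemma le_gammaRatioQuot {x : ℝ} (hx : 1 ≤ x) :
    (x / (x + 1)) ^ 2 ≤ gammaRatioQuot x := by
  have h1 : 0 < 2 * x - 1 := by linarith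
  have h := pow_le_pow_left₀ (by positivity) (le_gammaRatio_sq (show 0 < x by linarith)) 2
  rw [← pow_mul] at h
  unfold gammaRatioQuot
  rw [le_div_iff₀ (by positivity)]
  refine le_trans ?_ (mul_le_mul_of_nonneg_right h (by positivity))
  rw [div_pow, div_pow, div_mul_eq_mul_div, div_mul_eq_mul_div, div_le_div_iff₀ (by positivity)
    (by positivity)]
  have : 0 ≤ x ^ 4 * (x + 1) ^ 2 := by positivity
  nlinarith

/-- The quotient does not increase along x, x + 2, x + 4, …, while the crude bound
`le_gammaRatioQuot` tends to 1 there. -/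
lemma one_le_gammaRatioQuot {x : ℝ} (hx : 1 ≤ x) : 1 ≤ gammaRatioQuot x := by
  have h1 : ∀ k : ℕ, gammaRatioQuot (x + 2 * k) ≤ gammaRatioQuot x := by
    intro k
    induction k with
    | zero => simp
    | succ k ih =>
      refine le_trans ?_ ih
      have := gammaRatioQuot_add_two_le (x := x + 2 * k) (by
        have : (0 : ℝ) ≤ k := k.cast_nonneg
        linarith)
      rwa [show x + 2 * (k : ℝ) + 2 = x + 2 * ((k + 1 : ℕ) : ℝ) by push_cast; ring] at this
  have h2 : Tendsto (fun k : ℕ => x + 2 * (k : ℝ)) atTop atTop :=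
    tendsto_atTop_add_const_left _ _
      (tendsto_natCast_atTop_atTop.const_mul_atTop (by norm_num))
  have h3 : Tendsto (fun y : ℝ => (y / (y + 1)) ^ 2) atTop (𝓝 1) := by
    have h4 : Tendsto (fun y : ℝ => (1 - (y + 1)⁻¹) ^ 2) atTop (𝓝 ((1 - 0) ^ 2)) :=
      ((tendsto_inv_atTop_zero.comp (tendsto_atTop_add_const_right _ 1 tendsto_id)).const_sub
        1).pow 2
    simp only [sub_zero, one_pow] at h4
    refine h4.congr' ?_
    filter_upwards [eventually_gt_atTop 0] with y hy
    have h5 : 1 - (y + 1)⁻¹ = y / (y + 1) := by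
      rw [eq_div_iff (by positivity), sub_mul, inv_mul_cancel₀ (by positivity)]
      ring
    exact congrArg (· ^ 2) h5
  refine le_of_tendsto (h3.comp h2) (Eventually.of_forall fun k => ?_)
  refine (le_gammaRatioQuot ?_).trans (h1 k)
  have : (0 : ℝ) ≤ k := k.cast_nonneg
  linarith

lemma le_gammaRatio_pow_four {x : ℝ} (hx : 1 ≤ x) :
    x ^ 2 * (2 * x - 1) ≤ gammaRatio x ^ 4 * (4 * (2 * x + 1)) := by
  have h := one_le_gammaRatioQuot hx
  unfold gammaRatioQuot at h
  have h1 : 0 < 2 * x - 1 := by linarith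
  rwa [le_div_iff₀ (by positivity), one_mul] at h

lemma sub_le_gammaRatio_sq {x : ℝ} (hx : 1 ≤ x) : (2 * x - 1) / 4 ≤ gammaRatio x ^ 2 := by
  have h := le_gammaRatio_pow_four hx
  refine le_of_sq_le_sq ?_ (sq_nonneg _)
  rw [← pow_mul]
  have h3 : 0 < 4 * (2 * x + 1) := by linarith
  refine le_of_mul_le_mul_right (le_trans ?_ h) h3
  nlinarith

/-! ### The two factors of the steps -/

/-- The factor of the grid steps that does not depend on the number of layers. -/
noncomputable def stepFactor (x : ℝ) : ℝ := (x - 1 / 2) / gammaRatio x ^ 2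

/-- The factor of the grid steps that depends on the number `N / 2` of layers. -/
noncomputable def layerFactor (N x : ℝ) : ℝ :=
  1 / (2 * gammaRatio (N + x) * gammaRatio (N + 1 - x))

lemma stepFactor_pos {x : ℝ} (hx : 1 ≤ x) : 0 < stepFactor x :=
  div_pos (by linarith) (pow_pos (gammaRatio_pos (by linarith)) 2)

lemma stepFactor_mul_succ {x : ℝ} (hx : 1 ≤ x) :
    stepFactor x * stepFactor (x + 1) = (4 * x ^ 2 - 1) / x ^ 2 := by
  have h : gammaRatio x ^ 2 * gammaRatio (x + 1) ^ 2 = x ^ 2 / 4 := by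
    rw [← mul_pow, gammaRatio_mul_succ (by linarith)]; ring
  unfold stepFactor
  rw [div_mul_div_comm, h]
  field_simp
  ring

lemma stepFactor_le_two {x : ℝ} (hx : 1 ≤ x) : stepFactor x ≤ 2 := by
  have := sub_le_gammaRatio_sq hx
  unfold stepFactor
  rw [div_le_iff₀ (pow_pos (gammaRatio_pos (by linarith)) 2)]
  linarith

/-- Divide the explicit product of consecutive values by the upper bound 2 for the second one. -/
lemma le_stepFactor {x : ℝ} (hx : 1 ≤ x) : 2 - 1 / (2 * x ^ 2) ≤ stepFactor x := by
  have h1 := stepFactor_mul_succ hx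
  have h2 := stepFactor_le_two (show 1 ≤ x + 1 by linarith)
  have h3 := mul_le_mul_of_nonneg_left h2 (stepFactor_pos hx).le
  rw [h1] at h3
  have h4 : (4 * x ^ 2 - 1) / x ^ 2 = 2 * (2 - 1 / (2 * x ^ 2)) := by
    field_simp
    ring
  linarith

lemma stepFactor_sq_le {x : ℝ} (hx : 1 ≤ x) : stepFactor x ^ 2 ≤ (4 * x ^ 2 - 1) / x ^ 2 := by
  have h := le_gammaRatio_pow_four hx
  have hg := gammaRatio_pos (show 0 < x by linarith)
  have h1 : 0 < 2 * x - 1 := by linarith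
  unfold stepFactor
  rw [div_pow, ← pow_mul, div_le_div_iff₀ (by positivity) (by positivity)]
  nlinarith [mul_le_mul_of_nonneg_left h h1.le]

/-- The bound `stepFactor_sq_le` is exactly f(x)^2 ≤ f(x) f(x+1). -/
lemma stepFactor_le_succ {x : ℝ} (hx : 1 ≤ x) : stepFactor x ≤ stepFactor (x + 1) := by
  have h := stepFactor_sq_le hx
  rw [← stepFactor_mul_succ hx, sq] at h
  exact le_of_mul_le_mul_left h (stepFactor_pos hx)

lemma layerFactor_pos {N x : ℝ} (hx : 1 ≤ x) (hN : x ≤ N) : 0 < layerFactor N x := by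
  have := gammaRatio_pos (show 0 < N + x by linarith)
  have := gammaRatio_pos (show 0 < N + 1 - x by linarith)
  unfold layerFactor
  positivity

lemma layerFactor_mul_succ {N x : ℝ} (hx : 1 ≤ x) (hN : x < N) :
    layerFactor N x * layerFactor N (x + 1) = 1 / (N ^ 2 - x ^ 2) := by
  have h1 := gammaRatio_mul_succ (show 0 < N + x by linarith)
  have h2 := gammaRatio_mul_succ (show 0 < N - x by linarith)
  unfold layerFactor
  rw [show N + (x + 1) = N + x + 1 by ring, show N + 1 - (x + 1) = N - x by ring,
    show N + 1 - x = N - x + 1 by ring, div_mul_div_comm]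
  rw [show 2 * gammaRatio (N + x) * gammaRatio (N - x + 1) *
      (2 * gammaRatio (N + x + 1) * gammaRatio (N - x))
    = 4 * (gammaRatio (N + x) * gammaRatio (N + x + 1)) *
      (gammaRatio (N - x) * gammaRatio (N - x + 1)) by ring, h1, h2]
  congr 1
  · ring
  · ring

lemma layerFactor_sq_le {N x : ℝ} (hx : 1 ≤ x) (hN : x ≤ N) :
    layerFactor N x ^ 2 ≤ 1 / (N ^ 2 - (x - 1 / 2) ^ 2) := by
  have h1 := sub_le_gammaRatio_sq (show 1 ≤ N + x by linarith)
  have h2 := sub_le_gammaRatio_sq (show 1 ≤ N + 1 - x by linarith)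
  have h3 := mul_le_mul h1 h2 (by linarith) (sq_nonneg _)
  have h4 : 0 < N ^ 2 - (x - 1 / 2) ^ 2 := by nlinarith
  unfold layerFactor
  rw [div_pow, one_pow]
  refine one_div_le_one_div_of_le h4 ?_
  rw [mul_pow, mul_pow]
  nlinarith

/-- Again the square at x is compared with the product of the values at x and x + 1; the shift by
1/2 makes the comparison strict. -/
lemma layerFactor_lt_succ {N x : ℝ} (hx : 1 ≤ x) (hN : x < N) :
    layerFactor N x < layerFactor N (x + 1) := by
  have h0 := layerFactor_pos hx hN.le
  have h1 := layerFactor_sq_le hx hN.le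
  have h2 : 1 / (N ^ 2 - (x - 1 / 2) ^ 2) < 1 / (N ^ 2 - x ^ 2) :=
    one_div_lt_one_div_of_lt (by nlinarith) (by nlinarith)
  rw [← layerFactor_mul_succ hx hN] at h2
  exact lt_of_mul_lt_mul_left (by nlinarith) h0.le

/-! ### The explicit steps -/

/-- The `(m+1)`-st term of the sequence `α̂_1, α_1, α̂_2, α_2, …` of steps of the truncated measure
optimal grid with `ℓ` layers. -/
noncomputable def gridStep (ℓ m : ℕ) : ℝ :=
  2 / π * stepFactor ((m : ℝ) + 1) * layerFactor (2 * (ℓ : ℝ)) ((m : ℝ) + 1)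

lemma gridStep_pos {ℓ m : ℕ} (h : m < 2 * ℓ) : 0 < gridStep ℓ m := by
  have h1 : (m : ℝ) + 1 ≤ 2 * ℓ := by exact_mod_cast h
  have h2 : (1 : ℝ) ≤ m + 1 := by simp
  have := stepFactor_pos h2
  have := layerFactor_pos h2 h1
  unfold gridStep
  positivity

lemma gridStep_lt_succ {ℓ m : ℕ} (h : m + 1 < 2 * ℓ) : gridStep ℓ m < gridStep ℓ (m + 1) := by
  have h1 : (m : ℝ) + 1 < 2 * ℓ := by exact_mod_cast h
  have h2 : (1 : ℝ) ≤ m + 1 := by simp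
  unfold gridStep
  push_cast
  have h3 := layerFactor_pos h2 h1.le
  have h4 := stepFactor_pos (show (1 : ℝ) ≤ m + 1 + 1 by linarith)
  have h5 : 0 < 2 / π := by positivity
  rw [mul_assoc, mul_assoc]
  refine mul_lt_mul_of_pos_left ?_ h5
  exact mul_lt_mul' (stepFactor_le_succ h2) (layerFactor_lt_succ h2 h1) h3.le h4

/-- This product is what the three-term recurrence of the discrete Chebyshev polynomials requires of
consecutive steps. -/
lemma gridStep_mul_succ {ℓ m : ℕ} (h : m + 1 < 2 * ℓ) :
    gridStep ℓ m * gridStep ℓ (m + 1) = 4 * (4 * ((m : ℝ) + 1) ^ 2 - 1) /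
      (π ^ 2 * ((m : ℝ) + 1) ^ 2 * ((2 * (ℓ : ℝ)) ^ 2 - ((m : ℝ) + 1) ^ 2)) := by
  have h1 : (m : ℝ) + 1 < 2 * ℓ := by exact_mod_cast h
  have h2 : (1 : ℝ) ≤ m + 1 := by simp
  have h3 := stepFactor_mul_succ h2
  have h4 := layerFactor_mul_succ h2 h1
  have h5 : (2 * (ℓ : ℝ)) ^ 2 - ((m : ℝ) + 1) ^ 2 ≠ 0 := by
    have : 0 < (2 * (ℓ : ℝ)) ^ 2 - ((m : ℝ) + 1) ^ 2 := by nlinarith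
    exact this.ne'
  unfold gridStep
  push_cast
  calc _ = (2 / π) ^ 2 * (stepFactor ((m : ℝ) + 1) * stepFactor ((m : ℝ) + 1 + 1)) *
        (layerFactor (2 * (ℓ : ℝ)) ((m : ℝ) + 1) * layerFactor (2 * (ℓ : ℝ)) ((m : ℝ) + 1 + 1)) := by
        ring
    _ = _ := by
      rw [h3, h4, div_pow, div_mul_div_comm, div_mul_div_comm]
      congr 1
      ring

lemma gridStep_zero {ℓ : ℕ} (h : 0 < ℓ) : gridStep ℓ 0 = 1 / (2 * ℓ) := by
  have h1 : (0 : ℝ) < 2 * ℓ := by positivity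
  have h2 := gammaRatio_mul_succ h1
  unfold gridStep stepFactor layerFactor
  rw [Nat.cast_zero, zero_add, gammaRatio_one, div_pow, sq_sqrt pi_pos.le,
    show 2 * gammaRatio (2 * (ℓ : ℝ) + 1) * gammaRatio (2 * (ℓ : ℝ) + 1 - 1)
      = 2 * (gammaRatio (2 * (ℓ : ℝ)) * gammaRatio (2 * (ℓ : ℝ) + 1)) by
      rw [add_sub_cancel_right]; ring, h2]
  field_simp
  norm_num

/-! ### Discrete Chebyshev polynomials -/

/-- The coefficient `C(x, i) C(x + i, i)` of the shifted Legendre function of degree `x`. -/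
noncomputable def legendreCoeff (x : ℝ) : ℕ → ℝ
  | 0 => 1
  | i + 1 => legendreCoeff x i * ((x - i) * (x + i + 1)) / ((i : ℝ) + 1) ^ 2

lemma legendreCoeff_succ (x : ℝ) (i : ℕ) :
    legendreCoeff x (i + 1) * ((i : ℝ) + 1) ^ 2 =
      legendreCoeff x i * ((x - i) * (x + i + 1)) := by
  have : ((i : ℝ) + 1) ^ 2 ≠ 0 := by positivity
  rw [legendreCoeff]
  field_simp

/-- With its companion for x - 1, this expresses all neighbouring degrees through one coefficient,
so that `legendreCoeff_recurrence` becomes a polynomial identity. -/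
lemma legendreCoeff_add_one_succ (x : ℝ) (i : ℕ) :
    legendreCoeff (x + 1) (i + 1) * ((i : ℝ) + 1) ^ 2 =
      (x + i + 1) * (x + i + 2) * legendreCoeff x i := by
  induction i with
  | zero => rw [legendreCoeff_succ]; simp only [legendreCoeff]; push_cast; ring
  | succ i ih =>
    have h0 : ((i : ℝ) + 1) ^ 2 ≠ 0 := by positivity
    have h1 := legendreCoeff_succ (x + 1) (i + 1)
    have h2 := legendreCoeff_succ x i
    rw [h1]
    apply mul_left_cancel₀ h0
    push_cast
    linear_combination (x + 1 - (i + 1)) * (x + 1 + (i + 1) + 1) * ih -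
      (x + i + 2) * (x + i + 3) * h2

lemma legendreCoeff_sub_one_succ (x : ℝ) (i : ℕ) :
    legendreCoeff (x - 1) (i + 1) * ((i : ℝ) + 1) ^ 2 =
      (x - i) * (x - i - 1) * legendreCoeff x i := by
  induction i with
  | zero => rw [legendreCoeff_succ]; simp only [legendreCoeff]; push_cast; ring
  | succ i ih =>
    have h0 : ((i : ℝ) + 1) ^ 2 ≠ 0 := by positivity
    have h1 := legendreCoeff_succ (x - 1) (i + 1)
    have h2 := legendreCoeff_succ x i
    rw [h1]
    apply mul_left_cancel₀ h0
    push_cast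
    linear_combination (x - 1 - (i + 1)) * (x - 1 + (i + 1) + 1) * ih -
      (x - i - 1) * (x - i - 2) * h2

lemma legendreCoeff_eq_zero {n i : ℕ} (h : n < i) : legendreCoeff n i = 0 := by
  induction i with
  | zero => omega
  | succ i ih =>
    rw [legendreCoeff]
    rcases Nat.lt_succ_iff_lt_or_eq.mp h with h | h
    · rw [ih h]; simp
    · rw [h]; simp

/-- The quotient of `C(k, i)` by `C(M, i)`. -/
noncomputable def chooseQuot (M k i : ℕ) : ℝ := (k.choose i : ℝ) / (M.choose i : ℝ)

lemma chooseQuot_zero (M k : ℕ) : chooseQuot M k 0 = 1 := by simp [chooseQuot]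

lemma cast_choose_succ (k i : ℕ) :
    (k.choose (i + 1) : ℝ) * (i + 1) = k.choose i * ((k : ℝ) - i) := by
  rcases le_or_gt i k with h | h
  · have := Nat.choose_succ_right_eq k i
    rw [← Nat.cast_sub h]
    exact_mod_cast this
  · rw [Nat.choose_eq_zero_of_lt h, Nat.choose_eq_zero_of_lt (by omega)]; simp

lemma chooseQuot_succ {M k i : ℕ} (hk : k ≤ M) :
    chooseQuot M k (i + 1) * ((M : ℝ) - i) = chooseQuot M k i * ((k : ℝ) - i) := by
  have h1 := cast_choose_succ k i
  have h2 := cast_choose_succ M i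
  unfold chooseQuot
  rcases lt_trichotomy i M with h | h | h
  · have h3 : (M.choose i : ℝ) ≠ 0 := by exact_mod_cast (Nat.choose_pos h.le).ne'
    have h4 : (M.choose (i + 1) : ℝ) ≠ 0 := by exact_mod_cast (Nat.choose_pos h).ne'
    have h5 : (i : ℝ) + 1 ≠ 0 := by positivity
    rw [div_mul_eq_mul_div, div_mul_eq_mul_div, div_eq_div_iff h4 h3, ← h1]
    linear_combination (k.choose (i + 1) : ℝ) * (-h2)
  · subst h
    rw [sub_self, mul_zero]
    rcases hk.lt_or_eq with h | h
    · rw [Nat.choose_eq_zero_of_lt h]; simp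
    · rw [h]; simp
  · rw [Nat.choose_eq_zero_of_lt (show k < i by omega),
      Nat.choose_eq_zero_of_lt (show k < i + 1 by omega)]; simp

/-- The discrete Chebyshev function of degree `x` on the points `0, …, M`, at the point `k`. -/
noncomputable def discreteChebyshev (M k : ℕ) (x : ℝ) : ℝ :=
  ∑ i ∈ Finset.range (M + 1), (-1) ^ i * legendreCoeff x i * chooseQuot M k i

/-- The telescoping certificate of the three-term recurrence. -/
noncomputable def recurrenceCert (M k : ℕ) (x : ℝ) : ℕ → ℝ
  | 0 => 0
  | i + 1 => (-1) ^ i * (2 * (2 * x + 1)) * ((M : ℝ) - i) * legendreCoeff x i *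
      chooseQuot M k (i + 1)

lemma legendreCoeff_recurrence (M x : ℝ) (i : ℕ) :
    (x + 1) * (M - x) * legendreCoeff (x + 1) (i + 1)
      - (2 * x + 1) * (M - 2 * (i + 1)) * legendreCoeff x (i + 1)
      + x * (M + 1 + x) * legendreCoeff (x - 1) (i + 1)
      = 2 * (2 * x + 1) * (M - i) * legendreCoeff x i := by
  have h0 : ((i : ℝ) + 1) ^ 2 ≠ 0 := by positivity
  have h1 := legendreCoeff_succ x i
  have h2 := legendreCoeff_add_one_succ x i
  have h3 := legendreCoeff_sub_one_succ x i
  apply mul_left_cancel₀ h0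
  linear_combination (x + 1) * (M - x) * h2 - (2 * x + 1) * (M - 2 * (i + 1)) * h1
    + x * (M + 1 + x) * h3

/-- Replacing M - 2k by M - 2i leaves the excess 2(k - i), which `chooseQuot_succ` moves to index i
+ 1; this produces the telescoping difference. -/
lemma recurrence_term {M k : ℕ} (hk : k ≤ M) (x : ℝ) (i : ℕ) :
    (x + 1) * (M - x) * ((-1) ^ i * legendreCoeff (x + 1) i * chooseQuot M k i)
      - (2 * x + 1) * (M - 2 * k) * ((-1) ^ i * legendreCoeff x i * chooseQuot M k i)
      + x * (M + 1 + x) * ((-1) ^ i * legendreCoeff (x - 1) i * chooseQuot M k i)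
      = recurrenceCert M k x (i + 1) - recurrenceCert M k x i := by
  have h1 := chooseQuot_succ (i := i) hk
  cases i with
  | zero =>
    simp only [recurrenceCert, legendreCoeff, pow_zero, chooseQuot_zero] at h1 ⊢
    push_cast at h1 ⊢
    linear_combination (-(2 * (2 * x + 1))) * h1
  | succ i =>
    have h2 := legendreCoeff_recurrence M x i
    simp only [recurrenceCert]
    push_cast at h1 ⊢
    linear_combination (-1) ^ (i + 1) * chooseQuot M k (i + 1) * h2
      - (-1) ^ (i + 1) * legendreCoeff x (i + 1) * (2 * (2 * x + 1)) * h1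

lemma discreteChebyshev_recurrence {M k : ℕ} (hk : k ≤ M) (x : ℝ) :
    (x + 1) * (M - x) * discreteChebyshev M k (x + 1)
      = (2 * x + 1) * (M - 2 * k) * discreteChebyshev M k x
        - x * (M + 1 + x) * discreteChebyshev M k (x - 1) := by
  have h := Finset.sum_range_sub (recurrenceCert M k x) (M + 1)
  simp_rw [← recurrence_term hk x] at h
  rw [Finset.sum_add_distrib, Finset.sum_sub_distrib, ← Finset.mul_sum, ← Finset.mul_sum,
    ← Finset.mul_sum] at h
  -- The factor M - i vanishes at i = M.
  have h0 : recurrenceCert M k x (M + 1) = 0 := by simp [recurrenceCert]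
  have h1 : recurrenceCert M k x 0 = 0 := rfl
  rw [h0, h1] at h
  unfold discreteChebyshev
  linear_combination h

lemma discreteChebyshev_zero (M k : ℕ) : discreteChebyshev M k 0 = 1 := by
  unfold discreteChebyshev
  rw [Finset.sum_range_succ', Finset.sum_eq_zero]
  · simp [legendreCoeff, chooseQuot]
  · intro i _
    have := legendreCoeff_eq_zero (n := 0) (i := i + 1) (by omega)
    rw [Nat.cast_zero] at this
    rw [this]; simp

/-- Under k ↦ M - k the recurrence coefficient M - 2k changes sign. -/
lemma discreteChebyshev_reflect {M k : ℕ} (hk : k ≤ M) (n : ℕ) (hn : n ≤ M) :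
    discreteChebyshev M (M - k) n = (-1) ^ n * discreteChebyshev M k n := by
  induction n using Nat.strong_induction_on with
  | _ n ih =>
    cases n with
    | zero => simp [discreteChebyshev_zero]
    | succ n =>
      have h1 := discreteChebyshev_recurrence hk n
      have h2 := discreteChebyshev_recurrence (Nat.sub_le M k) n
      have h3 := ih n (by omega) (by omega)
      -- The factor n removes the term of degree -1 when n = 0.
      have h4 : (n : ℝ) * discreteChebyshev M (M - k) (n - 1) =
          n * ((-1) ^ (n + 1) * discreteChebyshev M k (n - 1)) := by
        cases n with
        | zero => simp
        | succ n =>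
          have := ih n (by omega) (by omega)
          push_cast
          rw [add_sub_cancel_right, this]
          ring
      rw [Nat.cast_sub hk] at h2
      have h5 : ((n : ℝ) + 1) * (M - n) ≠ 0 := by
        have : (n : ℝ) + 1 ≤ M := by exact_mod_cast hn
        have : (M : ℝ) - n ≠ 0 := by linarith
        positivity
      apply mul_left_cancel₀ h5
      push_cast
      rw [h2, h3]
      linear_combination -(-1) ^ (n + 1) * h1 - (M + 1 + n : ℝ) * h4

lemma sum_cast_choose (K i : ℕ) :
    ∑ k ∈ Finset.range K, (k.choose i : ℝ) = K.choose (i + 1) := by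
  induction K with
  | zero => simp
  | succ K ih =>
    rw [Finset.sum_range_succ, ih, Nat.choose_succ_succ]; push_cast; ring

lemma sum_chooseQuot {M i : ℕ} (hi : i ≤ M) :
    ∑ k ∈ Finset.range (M + 1), chooseQuot M k i = (M + 1) / (i + 1) := by
  unfold chooseQuot
  rw [← Finset.sum_div, sum_cast_choose]
  have h := Nat.add_one_mul_choose_eq M i
  have h1 : (M.choose i : ℝ) ≠ 0 := by exact_mod_cast (Nat.choose_pos hi).ne'
  have h2 : (i : ℝ) + 1 ≠ 0 := by positivity
  rw [div_eq_div_iff h1 h2]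
  exact_mod_cast h.symm

/-- Orthogonality to constants. The sum telescopes because (n - i)(n + i + 1) = n(n+1) - i(i+1). -/
lemma sum_discreteChebyshev {M n : ℕ} (hn : 0 < n) (hM : n ≤ M) :
    ∑ k ∈ Finset.range (M + 1), discreteChebyshev M k n = 0 := by
  unfold discreteChebyshev
  rw [Finset.sum_comm]
  have h1 : ∀ i ∈ Finset.range (M + 1), (n * (n + 1) : ℝ) *
      ∑ k ∈ Finset.range (M + 1), (-1) ^ i * legendreCoeff n i * chooseQuot M k i =
      -((M : ℝ) + 1) * ((-1) ^ (i + 1) * ((i + 1 : ℕ) * legendreCoeff n (i + 1))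
        - (-1) ^ i * (i * legendreCoeff n i)) := by
    intro i hi
    rw [← Finset.mul_sum, sum_chooseQuot (by simpa [Nat.lt_succ_iff] using hi)]
    have h2 := legendreCoeff_succ n i
    have h3 : (i : ℝ) + 1 ≠ 0 := by positivity
    have h4 : (-1 : ℝ) ^ (i + 1) = -(-1) ^ i := by ring
    rw [h4]
    push_cast
    field_simp
    linear_combination -h2
  have h5 : (n * (n + 1) : ℝ) ≠ 0 := by positivity
  apply mul_left_cancel₀ h5
  rw [Finset.mul_sum, Finset.sum_congr rfl h1, ← Finset.mul_sum,
    Finset.sum_range_sub (fun i => (-1) ^ i * ((i : ℝ) * legendreCoeff n i)),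
    legendreCoeff_eq_zero (show n < M + 1 by omega)]
  simp

/-- Even degrees are symmetric under reflection, so each half of the nodes carries half of the
vanishing sum. -/
lemma sum_half_discreteChebyshev {ℓ n : ℕ} (hn : 0 < n) (hM : 2 * n < 2 * ℓ) :
    ∑ k ∈ Finset.range ℓ, discreteChebyshev (2 * ℓ - 1) k (2 * n : ℕ) = 0 := by
  have h := sum_discreteChebyshev (M := 2 * ℓ - 1) (n := 2 * n) (by omega) (by omega)
  rw [show 2 * ℓ - 1 + 1 = ℓ + ℓ by omega, Finset.sum_range_add] at h
  have h2 : ∑ k ∈ Finset.range ℓ, discreteChebyshev (2 * ℓ - 1) (ℓ + k) (2 * n : ℕ) =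
      ∑ k ∈ Finset.range ℓ, discreteChebyshev (2 * ℓ - 1) k (2 * n : ℕ) := by
    rw [← Finset.sum_range_reflect]
    refine Finset.sum_congr rfl fun k hk => ?_
    have hk := Finset.mem_range.mp hk
    rw [show ℓ + (ℓ - 1 - k) = 2 * ℓ - 1 - k by omega,
      discreteChebyshev_reflect (by omega) _ (by omega)]
    simp
  rw [h2] at h
  linarith

/-! ### The difference equation as a first-order system -/

/-- Extension by zero of a vector to all natural indices. -/
def extendZero {ℓ : ℕ} (y : Fin ℓ → ℝ) (i : ℕ) : ℝ := if h : i < ℓ then y ⟨i, h⟩ else 0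

lemma extendZero_val {ℓ : ℕ} (y : Fin ℓ → ℝ) (i : Fin ℓ) : extendZero y i = y i := by
  simp [extendZero]

lemma extendZero_of_lt {ℓ : ℕ} (y : Fin ℓ → ℝ) {i : ℕ} (h : i < ℓ) :
    extendZero y i = y ⟨i, h⟩ := by
  simp [extendZero, h]

lemma gridMatrix_mulVec {ℓ : ℕ} (α αh y : Fin ℓ → ℝ) (i : Fin ℓ) :
    (gridMatrix α αh).mulVec y i = 1 / αh i * ((extendZero y (i + 1) - y i) / α i -
      prevInv α i * (y i - extendZero y (i - 1))) := by
  have h1 : ∀ j : Fin ℓ, gridMatrix α αh i j * y j =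
      (if j = i then -(1 / αh i) * (1 / α i + prevInv α i) * y j else 0) +
      (if j.val + 1 = i.val then 1 / (αh i * α j) * y j else 0) +
      (if i.val + 1 = j.val then 1 / (αh i * α i) * y j else 0) := by
    intro j
    simp only [gridMatrix, Matrix.of_apply]
    by_cases hj : j = i
    · subst hj; simp
    · by_cases hj1 : j.val + 1 = i.val
      · have : i.val + 1 ≠ j.val := by omega
        simp [hj, hj1, this]
      · simp [hj, hj1]
  have h2 : ∑ j : Fin ℓ, (if j.val + 1 = i.val then 1 / (αh i * α j) * y j else 0) =
      1 / αh i * (prevInv α i * extendZero y (i - 1)) := by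
    by_cases hi : 0 < i.val
    · have hlt : i.val - 1 < ℓ := by omega
      rw [Finset.sum_eq_single ⟨i.val - 1, hlt⟩]
      · rw [if_pos (by simp; omega), extendZero_of_lt y hlt, prevInv, if_pos hi, one_div_mul_eq_div,
          one_div_mul_eq_div, one_div_mul_eq_div, div_div, mul_comm]
      · intro j _ hj
        rw [if_neg]
        intro h
        exact hj (Fin.ext (by simp; omega))
      · simp
    · rw [Finset.sum_eq_zero, prevInv, if_neg hi]
      · simp
      · intro j _
        rw [if_neg (by omega)]
  have h3 : ∑ j : Fin ℓ, (if i.val + 1 = j.val then 1 / (αh i * α i) * y j else 0) =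
      1 / αh i * (1 / α i * extendZero y (i + 1)) := by
    by_cases hi : i.val + 1 < ℓ
    · rw [Finset.sum_eq_single ⟨i.val + 1, hi⟩]
      · rw [if_pos rfl, extendZero_of_lt y hi, ← mul_assoc, one_div_mul_one_div]
      · intro j _ hj
        rw [if_neg]
        intro h
        exact hj (Fin.ext h.symm)
      · simp
    · rw [Finset.sum_eq_zero]
      · simp [extendZero, hi]
      · intro j _
        rw [if_neg (by omega)]
  simp only [Matrix.mulVec, dotProduct]
  rw [Finset.sum_congr rfl fun j _ => h1 j, Finset.sum_add_distrib, Finset.sum_add_distrib, h2, h3,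
    Finset.sum_ite_eq' Finset.univ i, if_pos (Finset.mem_univ i)]
  ring

/-- The first-order form of the three-point difference equation with spectral parameter `-d ^ 2`,
for the node values `V` and the scaled differences `W`. -/
def IsLadder (ℓ : ℕ) (a ah : ℕ → ℝ) (d : ℝ) (V W : ℕ → ℝ) : Prop :=
  W 0 = 0 ∧ V ℓ = 0 ∧ ∀ i < ℓ, W (i + 1) = W i + ah i * d * V i ∧
    V (i + 1) = V i - a i * d * W (i + 1)

lemma IsLadder.smul {ℓ : ℕ} {a ah : ℕ → ℝ} {d : ℝ} {V W : ℕ → ℝ} (h : IsLadder ℓ a ah d V W)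
    (c : ℝ) : IsLadder ℓ a ah d (fun i => c * V i) (fun i => c * W i) := by
  obtain ⟨h0, h1, h2⟩ := h
  refine ⟨by simp [h0], by simp [h1], fun i hi => ?_⟩
  obtain ⟨h3, h4⟩ := h2 i hi
  dsimp only
  constructor
  · linear_combination c * h3
  · linear_combination c * h4

lemma exists_isLadder_of_mulVec {ℓ : ℕ} {α αh y : Fin ℓ → ℝ} {d : ℝ} (hα : ∀ i, 0 < α i)
    (hαh : ∀ i, 0 < αh i) (h : (gridMatrix α αh).mulVec y = (-d ^ 2) • y) :
    ∃ W, IsLadder ℓ (extendZero α) (extendZero αh) d (extendZero y) W := by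
  -- The first equation of the system forces these partial sums; the rows of the matrix equation
  -- then give the second.
  set W : ℕ → ℝ := fun i => ∑ p ∈ Finset.range i, extendZero αh p * d * extendZero y p with hW
  have hW1 : ∀ i, W (i + 1) = W i + extendZero αh i * d * extendZero y i := fun i =>
    Finset.sum_range_succ _ _
  refine ⟨W, by simp [hW], by simp [extendZero], fun i hi => ⟨hW1 i, ?_⟩⟩
  induction i with
  | zero =>
    have h1 := congrFun h ⟨0, hi⟩
    rw [gridMatrix_mulVec] at h1
    have h2 := (hα ⟨0, hi⟩).ne'
    have h3 := (hαh ⟨0, hi⟩).ne'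
    rw [hW1, extendZero_of_lt α hi, extendZero_of_lt αh hi, extendZero_of_lt y hi]
    have h4 : W 0 = 0 := by simp [hW]
    simp only [prevInv, lt_irrefl, if_false, zero_mul, sub_zero, Pi.smul_apply, smul_eq_mul] at h1
    field_simp at h1
    rw [h4]
    linear_combination h1
  | succ i ih =>
    have hi' : i < ℓ := by omega
    have h1 := congrFun h ⟨i + 1, hi⟩
    have ih := ih hi'
    rw [gridMatrix_mulVec] at h1
    have h2 := (hα ⟨i + 1, hi⟩).ne'
    have h3 := (hαh ⟨i + 1, hi⟩).ne'
    have h4 := (hα ⟨i, hi'⟩).ne'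
    rw [hW1, extendZero_of_lt α hi, extendZero_of_lt αh hi]
    rw [extendZero_of_lt α hi'] at ih
    rw [← extendZero_of_lt y hi] at h1
    simp only [prevInv, Nat.succ_pos, if_true, add_tsub_cancel_right, Pi.smul_apply, smul_eq_mul]
      at h1
    rw [← extendZero_of_lt y hi, show 1 / α ⟨i, hi'⟩ * (extendZero y (i + 1) - extendZero y i)
      = - d * W (i + 1) by rw [ih]; field_simp; ring] at h1
    field_simp at h1
    linear_combination h1

lemma mulVec_of_isLadder {ℓ : ℕ} {α αh : Fin ℓ → ℝ} {a ah V W : ℕ → ℝ} {d : ℝ}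
    (hα : ∀ i, 0 < α i) (hαh : ∀ i, 0 < αh i) (ha : ∀ i : Fin ℓ, a i = α i)
    (hah : ∀ i : Fin ℓ, ah i = αh i) (h : IsLadder ℓ a ah d V W) :
    (gridMatrix α αh).mulVec (fun i => V i) = (-d ^ 2) • (fun i : Fin ℓ => V i) := by
  obtain ⟨h0, h1, h2⟩ := h
  have hV : ∀ i ≤ ℓ, extendZero (fun i : Fin ℓ => V i) i = V i := by
    intro i hi
    rcases hi.lt_or_eq with hi | hi
    · exact extendZero_of_lt _ hi
    · rw [hi, h1]; simp [extendZero]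
  funext i
  rw [gridMatrix_mulVec, hV _ i.isLt, hV _ (by omega)]
  obtain ⟨h3, h4⟩ := h2 i i.isLt
  have h5 := (hα i).ne'
  have h6 := (hαh i).ne'
  rw [ha] at h4
  rw [hah] at h3
  have h7 : prevInv α i * (V i - V (i - 1)) = -d * W i := by
    unfold prevInv
    split_ifs with hi
    · have h8 := (h2 (i - 1) (by omega)).2
      have h9 := ha ⟨i - 1, by omega⟩
      have h10 := (hα ⟨i - 1, by omega⟩).ne'
      simp only at h9
      rw [Nat.sub_add_cancel hi, h9] at h8
      rw [h8]
      field_simp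
      ring
    · have : i.val = 0 := by omega
      rw [this, h0]; simp
  rw [h7, h4, h3]
  simp only [Pi.smul_apply, smul_eq_mul]
  field_simp
  ring

/-- Summation by parts: the differences of V_i W'_i telescope, and W' vanishes at 0 and V at ℓ. -/
lemma isLadder_sum_mul {ℓ : ℕ} {a ah V W V' W' : ℕ → ℝ} {d d' : ℝ}
    (h : IsLadder ℓ a ah d V W) (h' : IsLadder ℓ a ah d' V' W') :
    d' * ∑ i ∈ Finset.range ℓ, ah i * V i * V' i =
      d * ∑ i ∈ Finset.range ℓ, a i * W (i + 1) * W' (i + 1) := by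
  have h1 := Finset.sum_range_sub (fun i => V i * W' i) ℓ
  rw [h.2.1, h'.1, zero_mul, mul_zero, sub_zero] at h1
  rw [← sub_eq_zero, ← h1, Finset.mul_sum, Finset.mul_sum, ← Finset.sum_sub_distrib]
  refine Finset.sum_congr rfl fun i hi => ?_
  have h2 := (h.2.2 i (Finset.mem_range.mp hi)).2
  have h3 := (h'.2.2 i (Finset.mem_range.mp hi)).1
  linear_combination - V i * h3 - W' (i + 1) * h2

/-- Exchanging the two solutions gives a second linear relation between the same two sums, with
determinant ±(d^2 - d'^2). -/
lemma isLadder_orthogonal {ℓ : ℕ} {a ah V W V' W' : ℕ → ℝ} {d d' : ℝ}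
    (h : IsLadder ℓ a ah d V W) (h' : IsLadder ℓ a ah d' V' W') (hd : 0 < d) (hd' : 0 < d')
    (hne : d ≠ d') : ∑ i ∈ Finset.range ℓ, ah i * V i * V' i = 0 := by
  have h1 := isLadder_sum_mul h h'
  have h2 := isLadder_sum_mul h' h
  have h3 : ∑ i ∈ Finset.range ℓ, ah i * V' i * V i = ∑ i ∈ Finset.range ℓ, ah i * V i * V' i :=
    Finset.sum_congr rfl fun i _ => by ring
  have h4 : ∑ i ∈ Finset.range ℓ, a i * W' (i + 1) * W (i + 1) =
      ∑ i ∈ Finset.range ℓ, a i * W (i + 1) * W' (i + 1) :=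
    Finset.sum_congr rfl fun i _ => by ring
  rw [h3, h4] at h2
  have h5 : (d - d') * (d + d') * ∑ i ∈ Finset.range ℓ, ah i * V i * V' i = 0 := by
    linear_combination d * h2 - d' * h1
  have h6 : (d - d') * (d + d') ≠ 0 := mul_ne_zero (sub_ne_zero.mpr hne) (by positivity)
  exact (mul_eq_zero.mp h5).resolve_left h6

lemma isLadder_sum_dual {ℓ : ℕ} {a ah V W V' W' : ℕ → ℝ} {d d' : ℝ}
    (h : IsLadder ℓ a ah d V W) (h' : IsLadder ℓ a ah d' V' W') (hd : 0 < d) (hd' : 0 < d') :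
    ∑ i ∈ Finset.range ℓ, a i * W (i + 1) * W' (i + 1) =
      ∑ i ∈ Finset.range ℓ, ah i * V i * V' i := by
  have h1 := isLadder_sum_mul h h'
  rcases eq_or_ne d d' with hne | hne
  · rw [hne] at h1
    exact (mul_left_cancel₀ hd'.ne' h1).symm
  · have h2 := isLadder_orthogonal h h' hd hd' hne
    rw [h2, mul_zero] at h1
    rw [h2]
    exact (mul_eq_zero.mp h1.symm).resolve_left hd.ne'

/-! ### Dual orthogonality and uniqueness -/

/-- A one-sided inverse of a square matrix is two-sided; this is a diagonal entry of the reversed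
product. -/
lemma dual_orthonormal {ℓ : ℕ} {c : ℕ → ℝ} {X : Fin ℓ → ℕ → ℝ}
    (h : ∀ j k, ∑ i ∈ Finset.range ℓ, c i * X j i * X k i = if j = k then 1 else 0)
    {p : ℕ} (hp : p < ℓ) : c p * ∑ j, X j p ^ 2 = 1 := by
  set Q : Matrix (Fin ℓ) (Fin ℓ) ℝ := Matrix.of fun j i => X j i with hQ
  set R : Matrix (Fin ℓ) (Fin ℓ) ℝ := Matrix.of fun i k => c i * X k i with hR
  have h1 : Q * R = 1 := by
    ext j k
    rw [Matrix.mul_apply, Matrix.one_apply, ← h j k, Finset.sum_range]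
    refine Finset.sum_congr rfl fun i _ => ?_
    simp only [hQ, hR, Matrix.of_apply]
    ring
  have h3 : R * Q = 1 := mul_eq_one_comm.mp h1
  have h2 := congrFun (congrFun h3 ⟨p, hp⟩) ⟨p, hp⟩
  rw [Matrix.mul_apply, Matrix.one_apply_eq] at h2
  rw [← h2, Finset.mul_sum]
  refine Finset.sum_congr rfl fun i _ => ?_
  simp only [hQ, hR, Matrix.of_apply]
  ring

/-- A normalized family of solutions of the first-order system with the common initial value `s`. -/
structure IsLadderFamily (ℓ : ℕ) (a ah : ℕ → ℝ) (s : ℝ) (δ : Fin ℓ → ℝ) (V W : Fin ℓ → ℕ → ℝ) :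
    Prop where
  ladder : ∀ j, IsLadder ℓ a ah (δ j) (V j) (W j)
  norm : ∀ j, ∑ i ∈ Finset.range ℓ, ah i * V j i ^ 2 = 1
  init : ∀ j, V j 0 = s

lemma IsLadderFamily.orthonormal {ℓ : ℕ} {a ah : ℕ → ℝ} {s : ℝ} {δ : Fin ℓ → ℝ}
    {V W : Fin ℓ → ℕ → ℝ} (h : IsLadderFamily ℓ a ah s δ V W) (hδ : ∀ j, 0 < δ j)
    (hinj : Function.Injective δ) (j k : Fin ℓ) :
    ∑ i ∈ Finset.range ℓ, ah i * V j i * V k i = if j = k then 1 else 0 := by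
  split_ifs with hjk
  · subst hjk
    rw [← h.norm j]
    exact Finset.sum_congr rfl fun i _ => by ring
  · exact isLadder_orthogonal (h.ladder j) (h.ladder k) (hδ j) (hδ k) fun e => hjk (hinj e)

lemma IsLadderFamily.dual_step {ℓ : ℕ} {a ah : ℕ → ℝ} {s : ℝ} {δ : Fin ℓ → ℝ}
    {V W : Fin ℓ → ℕ → ℝ} (h : IsLadderFamily ℓ a ah s δ V W) (hδ : ∀ j, 0 < δ j)
    (hinj : Function.Injective δ) {p : ℕ} (hp : p < ℓ) : ah p = 1 / ∑ j, V j p ^ 2 :=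
  eq_one_div_of_mul_eq_one_left (dual_orthonormal (h.orthonormal hδ hinj) hp)

lemma IsLadderFamily.primary_step {ℓ : ℕ} {a ah : ℕ → ℝ} {s : ℝ} {δ : Fin ℓ → ℝ}
    {V W : Fin ℓ → ℕ → ℝ} (h : IsLadderFamily ℓ a ah s δ V W) (hδ : ∀ j, 0 < δ j)
    (hinj : Function.Injective δ) {p : ℕ} (hp : p < ℓ) : a p = 1 / ∑ j, W j (p + 1) ^ 2 := by
  refine eq_one_div_of_mul_eq_one_left
    (dual_orthonormal (X := fun j i => W j (i + 1)) (fun j k => ?_) hp)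
  rw [← h.orthonormal hδ hinj j k]
  exact isLadder_sum_dual (h.ladder j) (h.ladder k) (hδ j) (hδ k)

/-- The spectral data determine the steps. -/
lemma IsLadderFamily.unique {ℓ : ℕ} {a ah a' ah' : ℕ → ℝ} {s : ℝ} {δ : Fin ℓ → ℝ}
    {V W V' W' : Fin ℓ → ℕ → ℝ} (h : IsLadderFamily ℓ a ah s δ V W)
    (h' : IsLadderFamily ℓ a' ah' s δ V' W') (hδ : ∀ j, 0 < δ j)
    (hinj : Function.Injective δ) {p : ℕ} (hp : p < ℓ) : a p = a' p ∧ ah p = ah' p := by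
  have hah : ∀ i < ℓ, (∀ j, V j i = V' j i) → ah i = ah' i := by
    intro i hi hV
    rw [h.dual_step hδ hinj hi, h'.dual_step hδ hinj hi]
    simp_rw [hV]
  have hW : ∀ i < ℓ, (∀ j, V j i = V' j i) → (∀ j, W j i = W' j i) →
      ∀ j, W j (i + 1) = W' j (i + 1) := by
    intro i hi hV hW j
    rw [((h.ladder j).2.2 i hi).1, ((h'.ladder j).2.2 i hi).1, hV, hW, hah i hi hV]
  have ha : ∀ i < ℓ, (∀ j, V j i = V' j i) → (∀ j, W j i = W' j i) → a i = a' i := by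
    intro i hi hV hW0
    rw [h.primary_step hδ hinj hi, h'.primary_step hδ hinj hi]
    simp_rw [hW i hi hV hW0]
  -- At each index the known V gives α̂, hence the next W, hence α, hence the next V.
  have key : ∀ i < ℓ, (∀ j, V j i = V' j i) ∧ (∀ j, W j i = W' j i) := by
    intro i
    induction i with
    | zero => exact fun _ => ⟨fun j => by rw [h.init, h'.init],
        fun j => by rw [(h.ladder j).1, (h'.ladder j).1]⟩
    | succ i ih =>
      intro hi
      obtain ⟨h1, h2⟩ := ih (by omega)
      have h3 := hW i (by omega) h1 h2
      refine ⟨fun j => ?_, h3⟩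
      rw [((h.ladder j).2.2 i (by omega)).2, ((h'.ladder j).2.2 i (by omega)).2, h1, h3,
        ha i (by omega) h1 h2]
  exact ⟨ha p hp (key p hp).1 (key p hp).2, hah p hp (key p hp).1⟩

/-! ### Eigenvectors on the explicit grid -/

/-- The spectral parameters `π (j - 1/2)`. -/
noncomputable def gridFreq {ℓ : ℕ} (j : Fin ℓ) : ℝ := π * (((j.val : ℝ) + 1) - 1 / 2)

lemma gridFreq_pos {ℓ : ℕ} (j : Fin ℓ) : 0 < gridFreq j := by
  unfold gridFreq
  have : (0 : ℝ) ≤ j.val := Nat.cast_nonneg _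
  exact mul_pos pi_pos (by linarith)

lemma gridFreq_strictMono {ℓ : ℕ} : StrictMono (gridFreq (ℓ := ℓ)) := by
  intro i j h
  unfold gridFreq
  have : (i.val : ℝ) < j.val := by exact_mod_cast h
  exact mul_lt_mul_of_pos_left (by linarith) pi_pos

/-- The factors that turn the discrete Chebyshev polynomials into solutions of the first-order
system on the truncated measure optimal grid. -/
noncomputable def chebyshevScale (ℓ : ℕ) : ℕ → ℝ
  | 0 => 1
  | n + 1 => chebyshevScale ℓ n * gridStep ℓ n * π * (((n : ℝ) + 1) * (2 * ℓ - 1 - n)) /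
      (2 * (2 * n + 1))

lemma chebyshevScale_succ (ℓ n : ℕ) :
    chebyshevScale ℓ (n + 1) * (2 * (2 * n + 1)) =
      chebyshevScale ℓ n * gridStep ℓ n * π * (((n : ℝ) + 1) * (2 * ℓ - 1 - n)) := by
  have : (2 * (2 * n + 1) : ℝ) ≠ 0 := by positivity
  rw [chebyshevScale]
  field_simp

lemma gridStep_mul_chebyshevScale {ℓ n : ℕ} (h : n + 1 < 2 * ℓ) :
    gridStep ℓ (n + 1) * chebyshevScale ℓ (n + 1) * π * (((n : ℝ) + 1) * (2 * ℓ + n + 1)) =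
      chebyshevScale ℓ n * (2 * (2 * n + 3)) := by
  have h1 : (n : ℝ) + 1 < 2 * ℓ := by exact_mod_cast h
  have h2 := gridStep_mul_succ h
  have h3 := chebyshevScale_succ ℓ n
  have h4 : 0 < 2 * (ℓ : ℝ) - 1 - n := by linarith
  have h5 : (2 * (ℓ : ℝ)) ^ 2 - ((n : ℝ) + 1) ^ 2 = (2 * ℓ - 1 - n) * (2 * ℓ + n + 1) := by ring
  have h6 : (2 * (2 * n + 1) : ℝ) ≠ 0 := by positivity
  rw [h5, eq_div_iff (by positivity)] at h2
  apply mul_right_cancel₀ h6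
  apply mul_right_cancel₀ (show (n : ℝ) + 1 ≠ 0 by positivity)
  linear_combination (gridStep ℓ (n + 1) * π * (((n : ℝ) + 1) * (2 * ℓ + n + 1)) * (n + 1)) * h3
    + (chebyshevScale ℓ n * (n + 1)) * h2

lemma chebyshevScale_add_two {ℓ n : ℕ} (h : n + 1 < 2 * ℓ) :
    chebyshevScale ℓ (n + 2) * (((n : ℝ) + 1) * (2 * ℓ + n + 1)) =
      chebyshevScale ℓ n * (((n : ℝ) + 2) * (2 * ℓ - 2 - n)) := by
  have h1 := gridStep_mul_chebyshevScale h
  have h2 := chebyshevScale_succ ℓ (n + 1)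
  push_cast at h2
  have h3 : (2 * (2 * n + 3) : ℝ) ≠ 0 := by positivity
  apply mul_right_cancel₀ h3
  linear_combination (((n : ℝ) + 1) * (2 * ℓ + n + 1)) * h2 +
    (((n : ℝ) + 2) * (2 * ℓ - 2 - n)) * h1

/-- This vanishing yields the Dirichlet condition V_ℓ = 0. -/
lemma chebyshevScale_last {ℓ : ℕ} (h : 0 < ℓ) : chebyshevScale ℓ (2 * ℓ) = 0 := by
  obtain ⟨m, hm⟩ : ∃ m, 2 * ℓ = m + 1 := ⟨2 * ℓ - 1, by omega⟩
  have h1 : 2 * (ℓ : ℝ) = m + 1 := by exact_mod_cast hm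
  rw [hm, chebyshevScale, h1]
  simp

/-- The scaled discrete Chebyshev polynomials at the node that belongs to the frequency `j`. -/
noncomputable def scaledChebyshev {ℓ : ℕ} (j : Fin ℓ) (n : ℕ) : ℝ :=
  chebyshevScale ℓ n * discreteChebyshev (2 * ℓ - 1) (ℓ - 1 - j) n

lemma scaledChebyshev_zero {ℓ : ℕ} (j : Fin ℓ) : scaledChebyshev j 0 = 1 := by
  simp [scaledChebyshev, chebyshevScale, discreteChebyshev_zero]

lemma node_identity {ℓ : ℕ} (j : Fin ℓ) :
    ((2 * ℓ - 1 : ℕ) : ℝ) = 2 * ℓ - 1 ∧ ((ℓ - 1 - j.val : ℕ) : ℝ) = ℓ - 1 - j.val := by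
  have h := j.isLt
  constructor
  · rw [Nat.cast_sub (by omega)]; push_cast; ring
  · rw [Nat.sub_sub, Nat.cast_sub (by omega)]; push_cast; ring

lemma scaledChebyshev_one {ℓ : ℕ} (j : Fin ℓ) :
    scaledChebyshev j 1 = gridStep ℓ 0 * gridFreq j := by
  have h := discreteChebyshev_recurrence (M := 2 * ℓ - 1) (k := ℓ - 1 - j) (by omega) 0
  rw [(node_identity j).1, (node_identity j).2, discreteChebyshev_zero] at h
  have h1 := chebyshevScale_succ ℓ 0
  simp only [chebyshevScale, zero_add, Nat.cast_zero] at h1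
  unfold scaledChebyshev gridFreq
  simp only [chebyshevScale, Nat.cast_one, Nat.cast_zero, zero_add] at h ⊢
  linear_combination (gridStep ℓ 0 * π / 2) * h

-- At the node k = ℓ - 1 - j one has M - 2k = 2j + 1, so the frequency is π(M - 2k)/2.
lemma scaledChebyshev_add_two {ℓ n : ℕ} (j : Fin ℓ) (hn : n + 1 < 2 * ℓ) :
    scaledChebyshev j (n + 2) =
      gridStep ℓ (n + 1) * gridFreq j * scaledChebyshev j (n + 1) - scaledChebyshev j n := by
  have h := discreteChebyshev_recurrence (M := 2 * ℓ - 1) (k := ℓ - 1 - j) (by omega) (n + 1)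
  rw [(node_identity j).1, (node_identity j).2, add_sub_cancel_right,
    show (n : ℝ) + 1 + 1 = n + 2 by ring] at h
  have h1 := gridStep_mul_chebyshevScale hn
  have h2 := chebyshevScale_add_two hn
  have h3 : (((n : ℝ) + 1) * (2 * ℓ + n + 1)) ≠ 0 := by positivity
  unfold scaledChebyshev gridFreq
  push_cast
  apply mul_left_cancel₀ h3
  linear_combination chebyshevScale ℓ n * h
    + discreteChebyshev (2 * ℓ - 1) (ℓ - 1 - j) (n + 2) * h2
    - (j.val + 1 / 2) * discreteChebyshev (2 * ℓ - 1) (ℓ - 1 - j) (n + 1) * h1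

/-- The node values of the eigenvectors. -/
noncomputable def gridV {ℓ : ℕ} (j : Fin ℓ) (i : ℕ) : ℝ :=
  √2 * (-1) ^ i * scaledChebyshev j (2 * i)

/-- The scaled differences of the eigenvectors. -/
noncomputable def gridW {ℓ : ℕ} (j : Fin ℓ) : ℕ → ℝ
  | 0 => 0
  | i + 1 => √2 * (-1) ^ i * scaledChebyshev j (2 * i + 1)

lemma isLadder_grid {ℓ : ℕ} (j : Fin ℓ) :
    IsLadder ℓ (fun i => gridStep ℓ (2 * i + 1)) (fun i => gridStep ℓ (2 * i)) (gridFreq j)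
      (gridV j) (gridW j) := by
  have hj := j.isLt
  refine ⟨rfl, ?_, fun i hi => ⟨?_, ?_⟩⟩
  · simp [gridV, scaledChebyshev, chebyshevScale_last (show 0 < ℓ by omega)]
  · cases i with
    | zero =>
      simp only [gridW, gridV, mul_zero, zero_add, scaledChebyshev_one, scaledChebyshev_zero]
      ring
    | succ i =>
      have h := scaledChebyshev_add_two (n := 2 * i + 1) j (by omega)
      simp only [gridW, gridV]
      rw [show 2 * (i + 1) + 1 = 2 * i + 1 + 2 by ring, h,
        show 2 * (i + 1) = 2 * i + 1 + 1 by ring]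
      ring
  · have h := scaledChebyshev_add_two (n := 2 * i) j (by omega)
    simp only [gridW, gridV]
    rw [show 2 * (i + 1) = 2 * i + 2 by ring, h]
    ring

lemma gridV_zero {ℓ : ℕ} (j : Fin ℓ) : gridV j 0 = √2 := by
  simp [gridV, scaledChebyshev_zero]

lemma sum_gridV {ℓ i : ℕ} (hi : 0 < i) (hiℓ : i < ℓ) : ∑ j : Fin ℓ, gridV j i = 0 := by
  have h := sum_half_discreteChebyshev hi (show 2 * i < 2 * ℓ by omega)
  rw [← Finset.sum_range_reflect, Finset.sum_range] at h
  unfold gridV scaledChebyshev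
  rw [← Finset.mul_sum, ← Finset.mul_sum, h]
  simp

lemma isLadderFamily_grid (ℓ : ℕ) :
    IsLadderFamily ℓ (fun i => gridStep ℓ (2 * i + 1)) (fun i => gridStep ℓ (2 * i)) √2
      gridFreq gridV gridW := by
  refine ⟨isLadder_grid, fun j => ?_, gridV_zero⟩
  have hℓ : 0 < ℓ := by have := j.isLt; omega
  -- By orthogonality the squared norm of V_j equals its inner product with ∑_k V_k. That sum
  -- vanishes at every node except the first, so only α̂_1 · √2 · ℓ√2 = 1 remains.
  have h1 : ∑ k : Fin ℓ, ∑ i ∈ Finset.range ℓ, gridStep ℓ (2 * i) * gridV j i * gridV k i =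
      ∑ i ∈ Finset.range ℓ, gridStep ℓ (2 * i) * gridV j i ^ 2 := by
    rw [Finset.sum_eq_single j]
    · exact Finset.sum_congr rfl fun i _ => by ring
    · intro k _ hk
      exact isLadder_orthogonal (isLadder_grid j) (isLadder_grid k) (gridFreq_pos j)
        (gridFreq_pos k) fun e => hk (gridFreq_strictMono.injective e).symm
    · simp
  rw [← h1, Finset.sum_comm]
  simp_rw [← Finset.mul_sum]
  rw [Finset.sum_eq_single 0]
  · simp_rw [gridV_zero]
    have h2 : √2 * √2 = 2 := mul_self_sqrt (by norm_num)
    rw [mul_zero, gridStep_zero hℓ, Finset.sum_const, Finset.card_univ, Fintype.card_fin,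
      nsmul_eq_mul]
    have : (ℓ : ℝ) ≠ 0 := by positivity
    field_simp
    nlinarith
  · intro i hi hi0
    rw [sum_gridV (by omega) (Finset.mem_range.mp hi), mul_zero]
  · intro h
    exact absurd (Finset.mem_range.mpr hℓ) h

lemma isTruncatedMeasureGrid_gridStep (ℓ : ℕ) [NeZero ℓ] :
    IsTruncatedMeasureGrid (fun i : Fin ℓ => gridStep ℓ (2 * i + 1))
      (fun i : Fin ℓ => gridStep ℓ (2 * i)) := by
  have h1 : ∀ i : Fin ℓ, 0 < gridStep ℓ (2 * i + 1) := fun i => gridStep_pos (by omega)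
  have h2 : ∀ i : Fin ℓ, 0 < gridStep ℓ (2 * i) := fun i => gridStep_pos (by omega)
  refine ⟨h1, h2, gridFreq_strictMono, gridFreq_pos, fun j i => gridV j i, fun j => ⟨?_, ?_, ?_⟩⟩
  · exact mulVec_of_isLadder h1 h2 (fun _ => rfl) (fun _ => rfl) (isLadder_grid j)
  · rw [← (isLadderFamily_grid ℓ).norm j, Finset.sum_range]
  · change gridV j 0 ^ 2 = 2
    rw [gridV_zero]
    exact sq_sqrt (by norm_num)

lemma IsTruncatedMeasureGrid.exists_isLadderFamily {ℓ : ℕ} [NeZero ℓ] {α αh : Fin ℓ → ℝ}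
    (h : IsTruncatedMeasureGrid α αh) :
    ∃ V W, IsLadderFamily ℓ (extendZero α) (extendZero αh) √2 gridFreq V W := by
  obtain ⟨hα, hαh, -, -, Y, hY⟩ := h
  choose W hW using fun j => exists_isLadder_of_mulVec hα hαh (hY j).1
  -- Only the square of the first component is prescribed, so each eigenvector is multiplied by a
  -- sign.
  have hs : ∀ j, ∃ c : ℝ, c ^ 2 = 1 ∧ c * Y j 0 = √2 := by
    intro j
    have h1 : Y j 0 ^ 2 = √2 ^ 2 := by rw [(hY j).2.2, sq_sqrt (by norm_num)]
    rcases sq_eq_sq_iff_eq_or_eq_neg.mp h1 with h2 | h2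
    · exact ⟨1, by norm_num, by rw [h2, one_mul]⟩
    · exact ⟨-1, by norm_num, by rw [h2]; ring⟩
  choose c hc1 hc2 using hs
  refine ⟨fun j i => c j * extendZero (Y j) i, fun j i => c j * W j i, fun j => (hW j).smul _,
    fun j => ?_, fun j => ?_⟩
  · rw [← (hY j).2.1, Finset.sum_range]
    refine Finset.sum_congr rfl fun i _ => ?_
    rw [extendZero_val, extendZero_val, mul_pow, hc1, one_mul]
  · rw [← hc2 j, extendZero_of_lt _ (Nat.pos_of_neZero ℓ)]
    rfl

/-- The explicit formula for the steps of the truncated measure optimal grid. -/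
lemma IsTruncatedMeasureGrid.eq_gridStep {ℓ : ℕ} [NeZero ℓ] {α αh : Fin ℓ → ℝ}
    (h : IsTruncatedMeasureGrid α αh) (i : Fin ℓ) :
    α i = gridStep ℓ (2 * i + 1) ∧ αh i = gridStep ℓ (2 * i) := by
  obtain ⟨V, W, hVW⟩ := h.exists_isLadderFamily
  have := hVW.unique (isLadderFamily_grid ℓ) gridFreq_pos gridFreq_strictMono.injective i.isLt
  rwa [extendZero_val, extendZero_val] at this

/-! ### Asymptotics of the steps -/

lemma abs_stepFactor_mul_layerFactor_sub_two_le {N x : ℝ} (hx : 1 ≤ x) (hN : x + 1 ≤ N) :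
    |stepFactor x * (layerFactor N x * √(N ^ 2 - x ^ 2)) - 2| ≤
      1 / (2 * x ^ 2) + 2 / (N - x) := by
  have hS : 0 < N ^ 2 - x ^ 2 := by nlinarith
  have hu1 := le_stepFactor hx
  have hu2 := stepFactor_le_two hx
  have hu0 := stepFactor_pos hx
  have hv0 := layerFactor_pos hx (show x ≤ N by linarith)
  have hv1 := layerFactor_sq_le hx (show x ≤ N by linarith)
  have hw0 := layerFactor_pos (show 1 ≤ x + 1 by linarith) hN
  have hw1 := layerFactor_sq_le (show 1 ≤ x + 1 by linarith) hN
  have hvw := layerFactor_mul_succ hx (show x < N by linarith)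
  set u := stepFactor x
  set v := layerFactor N x
  set w := layerFactor N (x + 1)
  set r := v * √(N ^ 2 - x ^ 2) with hr
  have hr0 : 0 < r := by positivity
  have hr2 : r ^ 2 = v ^ 2 * (N ^ 2 - x ^ 2) := by rw [hr, mul_pow, sq_sqrt hS.le]
  have hr1 : r ≤ 1 := by
    rw [← sq_le_one_iff₀ hr0.le, hr2]
    have h3 : 0 < N ^ 2 - (x - 1 / 2) ^ 2 := by nlinarith
    rw [le_div_iff₀ h3] at hv1
    refine le_trans (mul_le_mul_of_nonneg_left ?_ (sq_nonneg v)) hv1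
    nlinarith
  -- The upper bound for w and the explicit product v w bound v from below, giving (N^2 - x^2)(1 -
  -- r^2) ≤ x + 1/4 ≤ N + x. Since r ≤ 1, a lower bound for r^2 suffices.
  have hr3 : 1 - 1 / (N - x) ≤ r := by
    have h1 : r ^ 2 ≤ r := by nlinarith
    refine le_trans ?_ h1
    have h3 : 0 < N ^ 2 - (x + 1 - 1 / 2) ^ 2 := by nlinarith
    rw [le_div_iff₀ h3] at hw1
    rw [eq_div_iff hS.ne'] at hvw
    have h4 : v ^ 2 * (N ^ 2 - x ^ 2) ^ 2 * w ^ 2 = 1 := by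
      have : (v * w * (N ^ 2 - x ^ 2)) ^ 2 = 1 := by rw [hvw]; norm_num
      linarith
    have h5 : N ^ 2 - (x + 1 - 1 / 2) ^ 2 ≤ v ^ 2 * (N ^ 2 - x ^ 2) ^ 2 := by
      have h6 := mul_le_mul_of_nonneg_left hw1 (show 0 ≤ v ^ 2 * (N ^ 2 - x ^ 2) ^ 2 by positivity)
      nlinarith
    have h7 : 0 < N - x := by linarith
    rw [hr2, sub_le_iff_le_add, ← sub_le_iff_le_add', le_div_iff₀ h7]
    have h8 : (N ^ 2 - x ^ 2) * (v ^ 2 * (N ^ 2 - x ^ 2)) = v ^ 2 * (N ^ 2 - x ^ 2) ^ 2 := by ring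
    have h9 : (N + x) * ((1 - v ^ 2 * (N ^ 2 - x ^ 2)) * (N - x)) ≤ (N + x) * 1 := by
      nlinarith
    exact le_of_mul_le_mul_left h9 (by linarith)
  have h7 : 0 < 1 / (N - x) := one_div_pos.mpr (by linarith)
  have h8 : 0 < 1 / (2 * x ^ 2) := by positivity
  have h9 : 2 / (N - x) = 2 * (1 / (N - x)) := by ring
  rw [h9, abs_le]
  constructor
  · nlinarith
  · nlinarith

lemma gridStep_eq_div {ℓ m : ℕ} (h : m + 1 < 2 * ℓ) : ∃ E : ℝ,
    |E| ≤ 1 / (2 * ((m : ℝ) + 1) ^ 2) + 2 / (2 * ℓ - ((m : ℝ) + 1)) ∧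
    gridStep ℓ m = (2 + E) / (π * √((ℓ : ℝ) ^ 2 - (((m : ℝ) + 1) / 2) ^ 2)) := by
  have h1 : (m : ℝ) + 1 + 1 ≤ 2 * ℓ := by exact_mod_cast h
  have h2 : (1 : ℝ) ≤ m + 1 := by simp
  refine ⟨_, abs_stepFactor_mul_layerFactor_sub_two_le h2 h1, ?_⟩
  have hS : 0 < (2 * (ℓ : ℝ)) ^ 2 - ((m : ℝ) + 1) ^ 2 := by nlinarith
  have h3 : √((ℓ : ℝ) ^ 2 - (((m : ℝ) + 1) / 2) ^ 2) =
      √((2 * (ℓ : ℝ)) ^ 2 - ((m : ℝ) + 1) ^ 2) / 2 := by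
    rw [show (ℓ : ℝ) ^ 2 - (((m : ℝ) + 1) / 2) ^ 2 =
      ((2 * (ℓ : ℝ)) ^ 2 - ((m : ℝ) + 1) ^ 2) / 2 ^ 2 by ring, sqrt_div hS.le,
      sqrt_sq (by norm_num)]
  have h4 := (sqrt_pos.mpr hS).ne'
  rw [h3, gridStep]
  generalize √((2 * (ℓ : ℝ)) ^ 2 - ((m : ℝ) + 1) ^ 2) = S at h4
  field_simp
  ring

/-- Here x = N, so one Gamma quotient is evaluated at the fixed argument 1, where it equals 1/√π.
Only the quotient at 4ℓ is asymptotic, which accounts for the different form. -/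
lemma gridStep_last {ℓ : ℕ} (h : 0 < ℓ) : ∃ E : ℝ, |E| ≤ 2 * (ℓ : ℝ)⁻¹ ∧
    gridStep ℓ (2 * ℓ - 1) = (√2 + E) / √(π * ℓ) := by
  have hℓ : (1 : ℝ) ≤ ℓ := by exact_mod_cast h
  have hm : ((2 * ℓ - 1 : ℕ) : ℝ) + 1 = 2 * ℓ := by
    rw [Nat.cast_sub (by omega)]; push_cast; ring
  have hu1 := le_stepFactor (show (1 : ℝ) ≤ 2 * ℓ by linarith)
  have hu2 := stepFactor_le_two (show (1 : ℝ) ≤ 2 * ℓ by linarith)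
  have hu0 := stepFactor_pos (show (1 : ℝ) ≤ 2 * ℓ by linarith)
  have hg0 := gammaRatio_pos (show (0 : ℝ) < 2 * ℓ + 2 * ℓ by linarith)
  have hg1 := gammaRatio_sq_le (show (0 : ℝ) < 2 * ℓ + 2 * ℓ by linarith)
  have hg2 := sub_le_gammaRatio_sq (show (1 : ℝ) ≤ 2 * ℓ + 2 * ℓ by linarith)
  have hs : 0 < √(ℓ : ℝ) := sqrt_pos.mpr (by linarith)
  have hp : 0 < √π := sqrt_pos.mpr pi_pos
  have h2 : 0 < √2 := by positivity
  have h22 : √2 ^ 2 = 2 := sq_sqrt (by norm_num)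
  have hs2 : √(ℓ : ℝ) ^ 2 = ℓ := sq_sqrt (by linarith)
  have hp2 : √π ^ 2 = π := sq_sqrt pi_pos.le
  rw [gridStep, hm, layerFactor, add_sub_cancel_left, gammaRatio_one]
  set u := stepFactor (2 * ℓ)
  set g := gammaRatio (2 * ℓ + 2 * ℓ)
  refine ⟨u * √ℓ / g - √2, ?_, ?_⟩
  · set r := √2 * √ℓ / g with hr
    have hE : u * √ℓ / g - √2 = √2 * (u * r / 2 - 1) := by
      rw [hr]
      field_simp
      linear_combination (-(u * √(ℓ : ℝ))) * h22
    have hr0 : 0 < r := by positivity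
    have hr2 : r ^ 2 = 2 * ℓ / g ^ 2 := by rw [hr, div_pow, mul_pow, h22, hs2]
    have hi : 0 < (ℓ : ℝ)⁻¹ := by positivity
    have hi1 : (ℓ : ℝ)⁻¹ ≤ 1 := inv_le_one_of_one_le₀ hℓ
    have hli : (ℓ : ℝ) * (ℓ : ℝ)⁻¹ = 1 := mul_inv_cancel₀ (by linarith)
    have hr1 : 1 ≤ r := by
      rw [← one_le_sq_iff₀ hr0.le, hr2, le_div_iff₀ (by positivity)]
      linarith
    have hr3 : r ≤ 1 + (ℓ : ℝ)⁻¹ := by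
      have h3 : r ≤ r ^ 2 := by nlinarith
      refine h3.trans ?_
      rw [hr2, div_le_iff₀ (by positivity)]
      nlinarith
    have hu3 : 2 - (ℓ : ℝ)⁻¹ ≤ u := by
      refine le_trans ?_ hu1
      have : 1 / (2 * (2 * (ℓ : ℝ)) ^ 2) ≤ (ℓ : ℝ)⁻¹ := by
        rw [← one_div]
        exact one_div_le_one_div_of_le (by linarith) (by nlinarith)
      linarith
    have h2' : √2 ≤ 2 := by nlinarith
    rw [hE, abs_mul, abs_of_pos h2]
    refine mul_le_mul h2' ?_ (abs_nonneg _) (by norm_num)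
    rw [abs_le]
    constructor
    · nlinarith
    · nlinarith
  · rw [sqrt_mul pi_pos.le]
    field_simp
    rw [hp2]
    ring

theorem lemma2 :
    -- for every number `ℓ ≥ 1` of layers the data determine exactly one grid
    (∀ (ℓ : ℕ) [NeZero ℓ],
      ∃! p : (Fin ℓ → ℝ) × (Fin ℓ → ℝ), IsTruncatedMeasureGrid p.1 p.2) ∧
    -- the monotone relation `α̂_1 < α_1 < α̂_2 < α_2 < ⋯ < α̂_ℓ < α_ℓ`
    (∀ (ℓ : ℕ) [NeZero ℓ] (α αh : Fin ℓ → ℝ), IsTruncatedMeasureGrid α αh →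
      (∀ j, αh j < α j) ∧ (∀ i j : Fin ℓ, i.val + 1 = j.val → α i < αh j)) ∧
    -- the asymptotics, with `j : Fin ℓ` standing for the number `j + 1`
    (∃ C : ℝ, ∀ (ℓ : ℕ) [NeZero ℓ] (α αh : Fin ℓ → ℝ), IsTruncatedMeasureGrid α αh →
      (∀ j : Fin ℓ, j.val + 1 < ℓ → ∃ E : ℝ,
        |E| ≤ C * (((ℓ : ℝ) - ((j.val : ℝ) + 1))⁻¹ + (((j.val : ℝ) + 1) ^ 2)⁻¹) ∧
        α j = (2 + E) / (Real.pi * √((ℓ : ℝ) ^ 2 - ((j.val : ℝ) + 1) ^ 2))) ∧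
      (∀ j : Fin ℓ, j.val + 1 = ℓ → ∃ E : ℝ,
        |E| ≤ C * (ℓ : ℝ)⁻¹ ∧
        α j = (√2 + E) / √(Real.pi * (ℓ : ℝ))) ∧
      (∀ j : Fin ℓ, ∃ E : ℝ,
        |E| ≤ C * (((ℓ : ℝ) + 1 - ((j.val : ℝ) + 1))⁻¹ + (((j.val : ℝ) + 1) ^ 2)⁻¹) ∧
        αh j = (2 + E) /
          (Real.pi * √((ℓ : ℝ) ^ 2 - (((j.val : ℝ) + 1) - 1 / 2) ^ 2)))) := by
  refine ⟨fun ℓ _ => ⟨(fun i => gridStep ℓ (2 * i + 1), fun i => gridStep ℓ (2 * i)),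
    isTruncatedMeasureGrid_gridStep ℓ, fun p hp => ?_⟩,
    fun ℓ _ α αh h => ⟨fun j => ?_, fun i j hij => ?_⟩, 2, fun ℓ _ α αh h =>
    ⟨fun j hj => ?_, fun j hj => ?_, fun j => ?_⟩⟩
  · exact Prod.ext (funext fun i => (hp.eq_gridStep i).1) (funext fun i => (hp.eq_gridStep i).2)
  · rw [(h.eq_gridStep j).1, (h.eq_gridStep j).2]
    exact gridStep_lt_succ (by omega)
  · rw [(h.eq_gridStep i).1, (h.eq_gridStep j).2, ← hij]
    exact gridStep_lt_succ (m := 2 * i + 1) (by omega)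
  · obtain ⟨E, hE, hα⟩ := gridStep_eq_div (ℓ := ℓ) (m := 2 * j + 1) (by omega)
    have hj1 : (j.val : ℝ) + 1 < ℓ := by exact_mod_cast hj
    have hj0 : (0 : ℝ) ≤ j.val := Nat.cast_nonneg _
    push_cast at hE hα
    refine ⟨E, hE.trans ?_, ?_⟩
    · have h1 : 1 / (2 * (2 * (j.val : ℝ) + 1 + 1) ^ 2) ≤ 2 * (((j.val : ℝ) + 1) ^ 2)⁻¹ := by
        rw [← div_eq_mul_inv, div_le_div_iff₀ (by positivity) (by positivity)]
        nlinarith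
      have h2 : 2 / (2 * (ℓ : ℝ) - (2 * (j.val : ℝ) + 1 + 1)) ≤
          2 * ((ℓ : ℝ) - ((j.val : ℝ) + 1))⁻¹ := by
        rw [← div_eq_mul_inv]
        exact div_le_div_of_nonneg_left (by norm_num) (by linarith) (by linarith)
      linarith
    · rw [(h.eq_gridStep j).1, hα, show (2 * (j.val : ℝ) + 1 + 1) / 2 = j.val + 1 by ring]
  · rw [(h.eq_gridStep j).1, show 2 * j.val + 1 = 2 * ℓ - 1 by omega]
    exact gridStep_last (by omega)
  · obtain ⟨E, hE, hα⟩ := gridStep_eq_div (ℓ := ℓ) (m := 2 * j) (by omega)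
    have hj1 : (j.val : ℝ) + 1 ≤ ℓ := by exact_mod_cast j.isLt
    have hj0 : (0 : ℝ) ≤ j.val := Nat.cast_nonneg _
    push_cast at hE hα
    refine ⟨E, hE.trans ?_, ?_⟩
    · have h1 : 1 / (2 * (2 * (j.val : ℝ) + 1) ^ 2) ≤ 2 * (((j.val : ℝ) + 1) ^ 2)⁻¹ := by
        rw [← div_eq_mul_inv, div_le_div_iff₀ (by positivity) (by positivity)]
        nlinarith
      -- This uses ℓ - j ≥ 1, and the constant 2 is attained at ℓ - j = 1.
      have h2 : 2 / (2 * (ℓ : ℝ) - (2 * (j.val : ℝ) + 1)) ≤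
          2 * ((ℓ : ℝ) + 1 - ((j.val : ℝ) + 1))⁻¹ := by
        rw [← div_eq_mul_inv]
        exact div_le_div_of_nonneg_left (by norm_num) (by linarith) (by linarith)
      linarith
    · rw [(h.eq_gridStep j).2, hα, show (2 * (j.val : ℝ) + 1) / 2 = j.val + 1 - 1 / 2 by ring]
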